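/- Work in the first-order language $\{\in\}$ with equality. Let BST be the theory with the axioms Empty set, Extensionality, Pair, Union, Cartesian Product, "$\omega$ exists" and the scheme of $\Delta_0$-Separation. "Model" means transitive set model of ZFC. Let LZFC be BST together with the axiom "every set belongs to a transitive model of ZFC", i.e. $$\forall x\,\exists y\,\bigl(x\in y\wedge y\text{ is transitive}\wedge (y,\in)\models \mathrm{ZFC}\bigr).$$ A transitive model $M$ of ZFC is called strongly extendible if for every set $x$ there is a transitive model $N$ of ZFC such that $x\in N$ and $(M,\in)\prec(N,\in)$. Let $\mathrm{LZFC}^{sext}$ be LZFC together with the axiom "every set belongs to a strongly extendible transitive model of ZFC". (The notions $(y,\in)\models\mathrm{ZFC}$ and $(M,\in)\prec(N,\in)$ are formalized in $\{\in\}$ by means of set codes of formulas and satisfaction relations.) Theorem. (i) $\mathrm{LZFC}^{sext}$ proves (equivalently, every model of the theory $\mathrm{LZFC}^{sext}$ satisfies) the Powerset axiom $\forall a\,\exists b\,\forall z\,(z\in b\leftrightarrow z\subseteq a)$. (ii) $\mathrm{LZFC}^{sext}$ proves (equivalently, every model of the theory $\mathrm{LZFC}^{sext}$ satisfies) $\Sigma_1$-Collection: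 for every $\Sigma_1$ formula $\phi(x,y,\bar v)$, i.e. $\phi=\exists z_1\cdots\exists z_k\,\psi$ with $k\ge 0$ and $\psi$ bounded, $$\forall \bar v\,\forall a\,\bigl[(\forall x\in a)\,\exists y\,\phi(x,y,\bar v)\rightarrow \exists b\,(\forall x\in a)(\exists y\in b)\,\phi(x,y,\bar v)\bigr].$$ -/

import Mathlib

open FirstOrder FirstOrder.Language

namespace LocalZFC

/-! ## The language of set theory and its formulas -/

/-- The only symbol of the language of set theory: the binary relation symbol for membership. -/
inductive MemSymbol : ℕ → Type
  | mem : MemSymbol 2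

/-- The first-order language `{∈}` (with equality as a logical symbol). -/
def setLang : FirstOrder.Language.{0, 0} := ⟨fun _ => Empty, MemSymbol⟩

/-- Formulas of `{∈}` whose free variables are among `v_0, …, v_{n-1}`.
A quantifier in front of a formula of `Fm (n + 1)` binds the variable `v_n`. -/
abbrev Fm (n : ℕ) : Type := setLang.BoundedFormula Empty n

variable {n : ℕ}

/-- The variable `v_i` of `Fm n`, as a variable of `Fm (n + 1)`. -/
prefix:max "⇡" => Fin.castSucc

/-- `x ∈ y` -/
def mem (x y : Fin n) : Fm n :=
  Relations.boundedFormula₂ (L := setLang) MemSymbol.mem (Term.var (Sum.inr x))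
    (Term.var (Sum.inr y))

/-- `x = y` -/
def eq (x y : Fin n) : Fm n :=
  Term.bdEqual (L := setLang) (Term.var (Sum.inr x)) (Term.var (Sum.inr y))

/-- `∀ z, f z` -/
def all (f : Fin (n + 1) → Fm (n + 1)) : Fm n := (f (Fin.last n)).all

/-- `∃ z, f z` -/
def ex (f : Fin (n + 1) → Fm (n + 1)) : Fm n := (f (Fin.last n)).ex

/-- `∀ z ∈ x, f z` -/
def ball (x : Fin n) (f : Fin (n + 1) → Fm (n + 1)) : Fm n := all fun z => mem z ⇡x ⟹ f z

/-- `∃ z ∈ x, f z` -/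
def bex (x : Fin n) (f : Fin (n + 1) → Fm (n + 1)) : Fm n := ex fun z => mem z ⇡x ⊓ f z

/-- The result of putting the variables `σ i` for the free variables `i` of `φ`. -/
def inst {α : Type} (φ : setLang.Formula α) (σ : α → Fin n) : Fm n :=
  BoundedFormula.relabel (fun i => (Sum.inr (σ i) : Empty ⊕ Fin n)) φ

/-! ## Bounded formulas and `Σ₁` formulas -/

/-- The atomic formula `u ∈ w`, where `u`, `w` are variables. -/
def memVar {α : Type} {n : ℕ} (u w : α ⊕ Fin n) : setLang.BoundedFormula α n :=
  Relations.boundedFormula₂ (L := setLang) MemSymbol.mem (Term.var u) (Term.var w)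

/-- The formula `v_n ∈ u`, where `u` is another variable. -/
def lastMem {α : Type} {n : ℕ} (u : α ⊕ Fin n) : setLang.BoundedFormula α (n + 1) :=
  memVar (Sum.inr (Fin.last n)) (Sum.map id Fin.castSucc u)

/-- `Δ₀` (bounded) formulas: all quantifiers are of the form `∀ x ∈ u` or `∃ x ∈ u`. -/
inductive IsDelta0 {α : Type} : ∀ {n : ℕ}, setLang.BoundedFormula α n → Prop
  | falsum {n : ℕ} : IsDelta0 (BoundedFormula.falsum (n := n))
  | equal {n : ℕ} (t₁ t₂ : setLang.Term (α ⊕ Fin n)) : IsDelta0 (BoundedFormula.equal t₁ t₂)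
  | rel {n l : ℕ} (R : setLang.Relations l) (ts : Fin l → setLang.Term (α ⊕ Fin n)) :
      IsDelta0 (BoundedFormula.rel R ts)
  | imp {n : ℕ} {φ ψ : setLang.BoundedFormula α n} :
      IsDelta0 φ → IsDelta0 ψ → IsDelta0 (φ.imp ψ)
  | ball {n : ℕ} (u : α ⊕ Fin n) {φ : setLang.BoundedFormula α (n + 1)} :
      IsDelta0 φ → IsDelta0 (∀' (lastMem u ⟹ φ))
  | bex {n : ℕ} (u : α ⊕ Fin n) {φ : setLang.BoundedFormula α (n + 1)} :
      IsDelta0 φ → IsDelta0 (∃' (lastMem u ⊓ φ))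

/-- `Σ₁` formulas `∃ x₁ … ∃ x_k, ψ` with `ψ` bounded (and `k ≥ 0`). -/
inductive IsSigma1 {α : Type} : ∀ {n : ℕ}, setLang.BoundedFormula α n → Prop
  | delta0 {n : ℕ} {φ : setLang.BoundedFormula α n} : IsDelta0 φ → IsSigma1 φ
  | ex {n : ℕ} {φ : setLang.BoundedFormula α (n + 1)} : IsSigma1 φ → IsSigma1 (∃' φ)

/-! ## Elementary set-theoretic notions, as formulas -/

/-- `x = ∅` -/
def isEmpty (x : Fin n) : Fm n := all fun z => ∼(mem z ⇡x)

/-- `x ⊆ y` -/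
def isSubset (x y : Fin n) : Fm n := ball x fun z => mem z ⇡y

/-- `x` is transitive. -/
def isTransitive (x : Fin n) : Fm n := ball x fun z => isSubset z ⇡x

/-- `p = {x, y}` -/
def isPair (x y p : Fin n) : Fm n := all fun z => mem z ⇡p ⇔ (eq z ⇡x ⊔ eq z ⇡y)

/-- `p = (x, y)`, that is, `p = {{x}, {x, y}}`. -/
def isOPair (x y p : Fin n) : Fm n :=
  all fun z => mem z ⇡p ⇔ (isPair ⇡x ⇡x z ⊔ isPair ⇡x ⇡y z)

/-- `(x, y) ∈ r` -/
def opairMem (x y r : Fin n) : Fm n := bex r fun p => isOPair ⇡x ⇡y p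

/-- `y = x ∪ {x}` -/
def isSucc (x y : Fin n) : Fm n := all fun z => mem z ⇡y ⇔ (mem z ⇡x ⊔ eq z ⇡x)

/-- `∅ ∈ w` and `w` is closed under `x ↦ x ∪ {x}`. -/
def isInductive (w : Fin n) : Fm n :=
  (bex w fun e => isEmpty e) ⊓ (ball w fun x => bex ⇡w fun y => isSucc ⇡x y)

/-- `w = ω`: `w` is the least inductive set. -/
def isOmega (w : Fin n) : Fm n :=
  isInductive w ⊓ all fun x => isInductive x ⟹ isSubset ⇡w x

/-- `x` is the natural number `k`. -/
def isNumeral : ℕ → {n : ℕ} → Fin n → Fm n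
  | 0, _, x => isEmpty x
  | k + 1, _, x => ex fun y => isNumeral k y ⊓ isSucc y ⇡x

/-- `s` is a function from `d` to `m`. -/
def isFunction (s d m : Fin n) : Fm n :=
  (ball s fun p => bex ⇡d fun i => bex ⇡⇡m fun x => isOPair ⇡i x ⇡⇡p) ⊓
  (ball d fun i => bex ⇡m fun x => opairMem ⇡i x ⇡⇡s ⊓
    all fun y => opairMem ⇡⇡i y ⇡⇡⇡s ⟹ eq y ⇡x)

/-- `t = s ∪ {(d, x)}` -/
def isExtension (s d x t : Fin n) : Fm n :=
  all fun p => mem p ⇡t ⇔ (mem p ⇡s ⊔ isOPair ⇡d ⇡x p)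

/-! ## Formulas coded as sets

Inside the universe, the formulas of `{∈}` with free variables among `v_i`, `i < d`, are coded by
`⌜⊥⌝ = (0, (∅, ∅))`, `⌜v_i = v_j⌝ = (1, (i, j))`, `⌜v_i ∈ v_j⌝ = (2, (i, j))`,
`⌜φ → ψ⌝ = (3, (⌜φ⌝, ⌜ψ⌝))` and `⌜∀ v_d φ⌝ = (4, (d, ⌜φ⌝))`, where `φ` in the last clause may have
the free variables `v_i`, `i < d + 1`. -/

/-- `c = (k, (a, b))`, where `k` is a natural number. -/
def isTagged (k : ℕ) (a b c : Fin n) : Fm n :=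
  ex fun t => ex fun p => isNumeral k ⇡t ⊓ isOPair ⇡⇡a ⇡⇡b p ⊓ isOPair ⇡t p ⇡⇡c

/-- `c = ⌜⊥⌝` -/
def isFalsumCode (c : Fin n) : Fm n := ex fun e => isEmpty e ⊓ isTagged 0 e e ⇡c

/-- `c = ⌜v_i = v_j⌝` -/
def isEqCode (i j c : Fin n) : Fm n := isTagged 1 i j c

/-- `c = ⌜v_i ∈ v_j⌝` -/
def isMemCode (i j c : Fin n) : Fm n := isTagged 2 i j c

/-- `c = ⌜φ → ψ⌝`, where `a = ⌜φ⌝` and `b = ⌜ψ⌝`. -/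
def isImpCode (a b c : Fin n) : Fm n := isTagged 3 a b c

/-- `c = ⌜∀ v_d φ⌝`, where `a = ⌜φ⌝`. -/
def isAllCode (d a c : Fin n) : Fm n := isTagged 4 d a c

/-- `F` contains every pair `(d, ⌜φ⌝)` with `d ∈ w` that is obtained from members of `F` by one of
the formation rules for a formula `φ` with free variables among `v_i`, `i < d`. -/
def isFormationClosed (w F : Fin n) : Fm n :=
  ball w fun d =>
    (all fun c => isFalsumCode c ⟹ opairMem ⇡d c ⇡⇡F) ⊓
    (ball d fun i => ball ⇡d fun j => all fun c =>
      (isEqCode ⇡⇡i ⇡j c ⊔ isMemCode ⇡⇡i ⇡j c) ⟹ opairMem ⇡⇡⇡d c ⇡⇡⇡⇡F) ⊓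
    (all fun a => all fun b => all fun c =>
      (opairMem ⇡⇡⇡d ⇡⇡a ⇡⇡⇡⇡F ⊓ opairMem ⇡⇡⇡d ⇡b ⇡⇡⇡⇡F ⊓ isImpCode ⇡⇡a ⇡b c) ⟹
        opairMem ⇡⇡⇡d c ⇡⇡⇡⇡F) ⊓
    (all fun e => all fun a => all fun c =>
      (isSucc ⇡⇡⇡d ⇡⇡e ⊓ opairMem ⇡⇡e ⇡a ⇡⇡⇡⇡F ⊓ isAllCode ⇡⇡⇡d ⇡a c) ⟹
        opairMem ⇡⇡⇡d c ⇡⇡⇡⇡F)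

/-- For `w = ω`: `F` is the set of all pairs `(d, ⌜φ⌝)`, where `d ∈ ω` and `φ` is a formula of
`{∈}` with free variables among `v_i`, `i < d`. -/
def isFormulaSet (w F : Fin n) : Fm n :=
  isFormationClosed w F ⊓ all fun X => isFormationClosed ⇡w X ⟹ isSubset ⇡F X

/-- For `w = ω` and `F` the set of formulas: `T` is a satisfaction relation of the structure
`(m, ∈)`, that is, Tarski's clauses hold when `(⌜φ⌝, s) ∈ T` is read as `(m, ∈) ⊨ φ[s]`, for all
`(d, ⌜φ⌝) ∈ F` and all `s : d → m`. -/
def isSatRelation (w F m T : Fin n) : Fm n :=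
  ball w fun d => all fun s => isFunction s ⇡d ⇡⇡m ⟹
    (all fun c => isFalsumCode c ⟹ ∼(opairMem c ⇡s ⇡⇡⇡T)) ⊓
    (ball ⇡d fun i => ball ⇡⇡d fun j => all fun c => isEqCode ⇡⇡i ⇡j c ⟹
      (opairMem c ⇡⇡⇡s ⇡⇡⇡⇡⇡T ⇔
        ex fun x => opairMem ⇡⇡⇡i x ⇡⇡⇡⇡s ⊓ opairMem ⇡⇡j x ⇡⇡⇡⇡s)) ⊓
    (ball ⇡d fun i => ball ⇡⇡d fun j => all fun c => isMemCode ⇡⇡i ⇡j c ⟹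
      (opairMem c ⇡⇡⇡s ⇡⇡⇡⇡⇡T ⇔
        ex fun x => ex fun y =>
          opairMem ⇡⇡⇡⇡i ⇡x ⇡⇡⇡⇡⇡s ⊓ opairMem ⇡⇡⇡j y ⇡⇡⇡⇡⇡s ⊓ mem ⇡x y)) ⊓
    (all fun a => all fun b => all fun c =>
      (opairMem ⇡⇡⇡⇡d ⇡⇡a ⇡⇡⇡⇡⇡F ⊓ opairMem ⇡⇡⇡⇡d ⇡b ⇡⇡⇡⇡⇡F ⊓ isImpCode ⇡⇡a ⇡b c) ⟹
        (opairMem c ⇡⇡⇡s ⇡⇡⇡⇡⇡T ⇔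
          (opairMem ⇡⇡a ⇡⇡⇡s ⇡⇡⇡⇡⇡T ⟹ opairMem ⇡b ⇡⇡⇡s ⇡⇡⇡⇡⇡T))) ⊓
    (all fun e => all fun a => all fun c =>
      (isSucc ⇡⇡⇡⇡d ⇡⇡e ⊓ opairMem ⇡⇡e ⇡a ⇡⇡⇡⇡⇡F ⊓ isAllCode ⇡⇡⇡⇡d ⇡a c) ⟹
        (opairMem c ⇡⇡⇡s ⇡⇡⇡⇡⇡T ⇔
          ball ⇡⇡⇡⇡⇡m fun x => all fun t =>
            isExtension ⇡⇡⇡⇡⇡s ⇡⇡⇡⇡⇡⇡d ⇡x t ⟹ opairMem ⇡⇡⇡a t ⇡⇡⇡⇡⇡⇡⇡T))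

/-- The index of a variable; the language has no other terms. -/
def varIndex {k : ℕ} : setLang.Term (Empty ⊕ Fin k) → ℕ
  | .var (Sum.inl e) => e.elim
  | .var (Sum.inr i) => i
  | .func f _ => Empty.elim f

/-- `c = ⌜φ⌝`, for an actual formula `φ`. -/
def isCodeOf : {k : ℕ} → Fm k → {n : ℕ} → Fin n → Fm n
  | _, .falsum, _, c => isFalsumCode c
  | _, .equal t₁ t₂, _, c => ex fun i => ex fun j =>
      isNumeral (varIndex t₁) ⇡i ⊓ isNumeral (varIndex t₂) j ⊓ isEqCode ⇡i j ⇡⇡c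
  | _, .rel MemSymbol.mem ts, _, c => ex fun i => ex fun j =>
      isNumeral (varIndex (ts 0)) ⇡i ⊓ isNumeral (varIndex (ts 1)) j ⊓ isMemCode ⇡i j ⇡⇡c
  | _, .imp φ ψ, _, c => ex fun a => ex fun b =>
      isCodeOf φ ⇡a ⊓ isCodeOf ψ b ⊓ isImpCode ⇡a b ⇡⇡c
  | k, .all φ, _, c => ex fun d => ex fun a =>
      isNumeral k ⇡d ⊓ isCodeOf φ a ⊓ isAllCode ⇡d a ⇡⇡c

/-- `(⌜σ⌝, ∅) ∈ T`: the sentence `σ` is true according to the satisfaction relation `T`. -/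
def isTrueIn (σ : setLang.Sentence) (T : Fin n) : Fm n :=
  ex fun c => ex fun e => isCodeOf σ ⇡c ⊓ isEmpty e ⊓ opairMem ⇡c e ⇡⇡T

/-! ## Axioms -/

/-- There is an empty set. -/
def emptyAx : setLang.Sentence := ex fun x : Fin 1 => isEmpty x

def extensionalityAx : setLang.Sentence :=
  all fun x : Fin 1 => all fun y => (all fun z => mem z ⇡⇡x ⇔ mem z ⇡y) ⟹ eq ⇡x y

def pairAx : setLang.Sentence :=
  all fun x : Fin 1 => all fun y => ex fun p => isPair ⇡⇡x ⇡y p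

def unionAx : setLang.Sentence :=
  all fun x : Fin 1 => ex fun u => all fun z => mem z ⇡u ⇔ bex ⇡⇡x fun y => mem ⇡z y

/-- For all `a`, `b` the set `a × b` exists. -/
def productAx : setLang.Sentence :=
  all fun a : Fin 1 => all fun b => ex fun c => all fun p =>
    mem p ⇡c ⇔ bex ⇡⇡⇡a fun x => bex ⇡⇡⇡b fun y => isOPair ⇡x y ⇡⇡p

/-- The set `ω` exists. -/
def omegaAx : setLang.Sentence := ex fun w : Fin 1 => isOmega w

def powersetAx : setLang.Sentence :=
  all fun a : Fin 1 => ex fun b => all fun z => mem z ⇡b ⇔ isSubset z ⇡⇡a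

/-- There is an inductive set. -/
def infinityAx : setLang.Sentence := ex fun w : Fin 1 => isInductive w

/-- Every nonempty set has an `∈`-minimal element. -/
def foundationAx : setLang.Sentence :=
  all fun x : Fin 1 => (ex fun y => mem y ⇡x) ⟹
    bex x fun y => ball y fun z => ∼(mem z ⇡⇡x)

/-- Every set of pairwise disjoint nonempty sets has a set of representatives. -/
def choiceAx : setLang.Sentence :=
  all fun x : Fin 1 =>
    ((ball x fun u => ex fun z => mem z ⇡u) ⊓
      (ball x fun u => ball ⇡x fun v =>
        (ex fun z => mem z ⇡⇡u ⊓ mem z ⇡v) ⟹ eq ⇡u v)) ⟹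
    ex fun c => ball ⇡x fun u => ex fun z =>
      (mem z ⇡u ⊓ mem z ⇡⇡c) ⊓ all fun y => (mem y ⇡⇡u ⊓ mem y ⇡⇡⇡c) ⟹ eq y ⇡z

/-- The universal closure of `∀ a ∃ b ∀ x (x ∈ b ↔ x ∈ a ∧ φ(x, v_0, …, v_{n-1}))`. -/
def separationAx (φ : setLang.Formula (Fin n ⊕ Fin 1)) : setLang.Sentence :=
  BoundedFormula.alls (n := n) <| all fun a => ex fun b => all fun x =>
    mem x ⇡b ⇔ (mem x ⇡⇡a ⊓ inst φ (Sum.elim (fun i => ⇡⇡⇡i) ![x]))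

/-- The universal closure of
`∀ a ((∀ x ∈ a) ∃ y φ(x, y, v_0, …, v_{n-1}) → ∃ b (∀ x ∈ a) (∃ y ∈ b) φ(x, y, v_0, …, v_{n-1}))`. -/
def collectionAx (φ : setLang.Formula (Fin n ⊕ Fin 2)) : setLang.Sentence :=
  BoundedFormula.alls (n := n) <| all fun a =>
    (ball a fun x => ex fun y => inst φ (Sum.elim (fun i => ⇡⇡⇡i) ![⇡x, y])) ⟹
    ex fun b => ball ⇡a fun x => bex ⇡b fun y =>
      inst φ (Sum.elim (fun i => ⇡⇡⇡⇡i) ![⇡x, y])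

/-- The axioms of ZFC other than the schemes of Separation and Replacement. -/
def zfcSingleAxioms : List setLang.Sentence :=
  [extensionalityAx, foundationAx, pairAx, unionAx, powersetAx, infinityAx, choiceAx]

/-! ## Models of ZFC inside the universe -/

/-- The structure `(m, ∈)` with satisfaction relation `T` satisfies the Separation scheme: for all
`φ` (in the variables `v_i`, `i < d + 1`), all `s : d → m` and all `a ∈ m` there is `b ∈ m` such
that for all `x ∈ m`, `x ∈ b` if and only if `x ∈ a` and `(m, ∈) ⊨ φ[s, x]`. -/
def satisfiesSeparation (w F m T : Fin n) : Fm n :=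
  ball w fun d => all fun e => all fun c => all fun s =>
    (isSucc ⇡⇡⇡d ⇡⇡e ⊓ opairMem ⇡⇡e ⇡c ⇡⇡⇡⇡F ⊓ isFunction s ⇡⇡⇡d ⇡⇡⇡⇡m) ⟹
    ball ⇡⇡⇡⇡m fun a => bex ⇡⇡⇡⇡⇡m fun b => ball ⇡⇡⇡⇡⇡⇡m fun x =>
      mem x ⇡b ⇔ (mem x ⇡⇡a ⊓
        ex fun t => isExtension ⇡⇡⇡⇡s ⇡⇡⇡⇡⇡⇡⇡d ⇡x t ⊓ opairMem ⇡⇡⇡⇡⇡c t ⇡⇡⇡⇡⇡⇡⇡⇡T)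

/-- `(c, s ∪ {(d, x), (d', y)}) ∈ T`, where `d' = d ∪ {d}`: when `c` is the code of a formula `φ`
in the variables `v_i`, `i < d + 2`, and `s` is defined on `d`, this is `φ[s, x, y]`. -/
def holdsAt₂ (c s d d' x y T : Fin n) : Fm n :=
  ex fun t => ex fun u =>
    isExtension ⇡⇡s ⇡⇡d ⇡⇡x ⇡t ⊓ isExtension ⇡t ⇡⇡d' ⇡⇡y u ⊓ opairMem ⇡⇡c u ⇡⇡T

/-- The structure `(m, ∈)` with satisfaction relation `T` satisfies the Replacement scheme: for all
`φ` (in the variables `v_i`, `i < d + 2`), all `s : d → m` and all `a ∈ m`, if for every `x ∈ m`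
with `x ∈ a` there is at most one `y ∈ m` such that `(m, ∈) ⊨ φ[s, x, y]`, then there is `b ∈ m`
such that for all `y ∈ m`, `y ∈ b` if and only if `(m, ∈) ⊨ φ[s, x, y]` for some `x ∈ m` with
`x ∈ a`. -/
def satisfiesReplacement (w F m T : Fin n) : Fm n :=
  ball w fun d => all fun d' => all fun e => all fun c => all fun s =>
    (isSucc ⇡⇡⇡⇡d ⇡⇡⇡d' ⊓ isSucc ⇡⇡⇡d' ⇡⇡e ⊓ opairMem ⇡⇡e ⇡c ⇡⇡⇡⇡⇡F ⊓
      isFunction s ⇡⇡⇡⇡d ⇡⇡⇡⇡⇡m) ⟹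
    ball ⇡⇡⇡⇡⇡m fun a =>
      (ball ⇡⇡⇡⇡⇡⇡m fun x => mem x ⇡a ⟹
        ball ⇡⇡⇡⇡⇡⇡⇡m fun y => ball ⇡⇡⇡⇡⇡⇡⇡⇡m fun z =>
          (holdsAt₂ ⇡⇡⇡⇡⇡c ⇡⇡⇡⇡s ⇡⇡⇡⇡⇡⇡⇡⇡d ⇡⇡⇡⇡⇡⇡⇡d' ⇡⇡x ⇡y ⇡⇡⇡⇡⇡⇡⇡⇡⇡T ⊓
            holdsAt₂ ⇡⇡⇡⇡⇡c ⇡⇡⇡⇡s ⇡⇡⇡⇡⇡⇡⇡⇡d ⇡⇡⇡⇡⇡⇡⇡d' ⇡⇡x z ⇡⇡⇡⇡⇡⇡⇡⇡⇡T) ⟹ eq ⇡y z) ⟹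
      bex ⇡⇡⇡⇡⇡⇡m fun b => ball ⇡⇡⇡⇡⇡⇡⇡m fun y =>
        mem y ⇡b ⇔ bex ⇡⇡⇡⇡⇡⇡⇡⇡m fun x => mem x ⇡⇡⇡a ⊓
          holdsAt₂ ⇡⇡⇡⇡⇡c ⇡⇡⇡⇡s ⇡⇡⇡⇡⇡⇡⇡⇡d ⇡⇡⇡⇡⇡⇡⇡d' x ⇡y ⇡⇡⇡⇡⇡⇡⇡⇡⇡T

/-- `(m, ∈) ⊨ ZFC` -/
def satisfiesZFC (m : Fin n) : Fm n :=
  ex fun w => ex fun F => ex fun T =>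
    isOmega ⇡⇡w ⊓ isFormulaSet ⇡⇡w ⇡F ⊓ isSatRelation ⇡⇡w ⇡F ⇡⇡⇡m T ⊓
    (zfcSingleAxioms.map fun σ => isTrueIn σ T).foldr (· ⊓ ·) ⊤ ⊓
    satisfiesSeparation ⇡⇡w ⇡F ⇡⇡⇡m T ⊓ satisfiesReplacement ⇡⇡w ⇡F ⇡⇡⇡m T

/-- `m` is a transitive model of ZFC. -/
def isModel (m : Fin n) : Fm n := isTransitive m ⊓ satisfiesZFC m

/-- `(m, ∈) ≺ (m', ∈)`: `m ⊆ m'`, and `(m, ∈) ⊨ φ[s]` if and only if `(m', ∈) ⊨ φ[s]`, for all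
formulas `φ` (in the variables `v_i`, `i < d`) and all `s : d → m`. -/
def isElementary (m m' : Fin n) : Fm n :=
  isSubset m m' ⊓
  ex fun w => ex fun F => ex fun T => ex fun T' =>
    isOmega ⇡⇡⇡w ⊓ isFormulaSet ⇡⇡⇡w ⇡⇡F ⊓
    isSatRelation ⇡⇡⇡w ⇡⇡F ⇡⇡⇡⇡m ⇡T ⊓ isSatRelation ⇡⇡⇡w ⇡⇡F ⇡⇡⇡⇡m' T' ⊓
    ball ⇡⇡⇡w fun d => all fun c => all fun s =>
      (opairMem ⇡⇡d ⇡c ⇡⇡⇡⇡⇡F ⊓ isFunction s ⇡⇡d ⇡⇡⇡⇡⇡⇡⇡m) ⟹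
        (opairMem ⇡c s ⇡⇡⇡⇡T ⇔ opairMem ⇡c s ⇡⇡⇡T')

/-- `m` is a strongly extendible model: `m` is a transitive model of ZFC, and every `x` belongs to
a transitive model `m'` of ZFC such that `(m, ∈) ≺ (m', ∈)`. -/
def isStronglyExtendible (m : Fin n) : Fm n :=
  isModel m ⊓
  all fun x => ex fun m' => mem ⇡x m' ⊓ isModel m' ⊓ isElementary ⇡⇡m m'

/-! ## The theories -/

/-- Basic set theory: Empty set, Extensionality, Pair, Union, Cartesian product, `ω` exists, and
the scheme of `Δ₀`-Separation. -/
def BST : setLang.Theory :=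
  {emptyAx, extensionalityAx, pairAx, unionAx, productAx, omegaAx} ∪
  {σ | ∃ (n : ℕ) (φ : setLang.Formula (Fin n ⊕ Fin 1)), IsDelta0 φ ∧ σ = separationAx φ}

/-- `Loc(ZFC)`: every set belongs to a transitive model of ZFC. -/
def locAx : setLang.Sentence :=
  all fun x : Fin 1 => ex fun m => mem ⇡x m ⊓ isModel m

/-- `Loc^sext(ZFC)`: every set belongs to a strongly extendible transitive model of ZFC. -/
def locSextAx : setLang.Sentence :=
  all fun x : Fin 1 => ex fun m => mem ⇡x m ⊓ isModel m ⊓ isStronglyExtendible m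

/-- Local ZFC. -/
def LZFC : setLang.Theory := BST ∪ {locAx}

/-- `LZFC^sext` -/
def LZFCsext : setLang.Theory := LZFC ∪ {locSextAx}

end LocalZFC

/-!
Let `V` be a model of `LZFCsext`. For a set `m` of `V` let `Elts m` be the actual structure
`({x | x ∈ m}, ∈)`. The two notions of truth in `m`, that of `V` (by codes and satisfaction
relations) and the actual one, agree on actual formulas (`code_mem_satRelation`), whether or not
the `ω` of `V` is standard. So a strongly extendible `m` is transitive, satisfies the Powerset
axiom, and for every `x` there is a transitive `m'` containing `x` such that `Elts m` is an
elementary substructure of `Elts m'` (`StronglyExtendible`).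

*Powerset.* Given `a`, take a strongly extendible `m ∋ a` and let `b` be the powerset of `a` in
the sense of `m`. If `z ⊆ a` is any set, choose `m'` as above with `z ∈ m'`; by elementarity `b` is
also the powerset of `a` in the sense of `m'`, so `z ∈ b`.

*Collection.* Given `a` and parameters, take a strongly extendible `m` that contains them. Then `m`
itself collects the witnesses: if `φ(x, y)` holds, where `x ∈ a` and `φ` is `Σ₁`, choose `m'` as
above that contains `y` and the witnesses for the quantifiers of `φ`. By `Δ₀` absoluteness
(`IsDelta0.realize_elts`), `Elts m'` satisfies `∃ y, φ(x, y)`, hence so does `Elts m`, and `Σ₁`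
formulas are preserved from `Elts m` to `V`.

Empty set, Extensionality, Pair and Union provide the codes of formulas and of finite sequences.
-/

namespace LocalZFC

variable {n : ℕ}

/-! ### Semantics of the basic formulas -/

variable {V : Type*} [setLang.Structure V]

/-- The membership relation of a structure for `{∈}`. -/
def Mem (x y : V) : Prop := Structure.RelMap (L := setLang) MemSymbol.mem ![x, y]

infix:50 " ∈ᵥ " => Mem

section Realize

variable {u : Empty → V} {v : Fin n → V}

@[simp]
theorem realize_mem {x y : Fin n} : (mem x y).Realize u v ↔ v x ∈ᵥ v y := by
  simpa [mem, Mem] using BoundedFormula.realize_rel₂ (L := setLang) (R := MemSymbol.mem)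
    (t₁ := Term.var (Sum.inr x)) (t₂ := Term.var (Sum.inr y)) (v := u) (xs := v)

@[simp]
theorem realize_eq {x y : Fin n} : (eq x y).Realize u v ↔ v x = v y := by
  simp [eq]

@[simp]
theorem realize_all {f : Fin (n + 1) → Fm (n + 1)} :
    (all f).Realize u v ↔ ∀ a, (f (Fin.last n)).Realize u (Fin.snoc v a) := by
  simp [all]

@[simp]
theorem realize_ex {f : Fin (n + 1) → Fm (n + 1)} :
    (ex f).Realize u v ↔ ∃ a, (f (Fin.last n)).Realize u (Fin.snoc v a) := by
  simp [ex]

@[simp]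
theorem realize_ball {x : Fin n} {f : Fin (n + 1) → Fm (n + 1)} :
    (ball x f).Realize u v ↔ ∀ a, a ∈ᵥ v x → (f (Fin.last n)).Realize u (Fin.snoc v a) := by
  simp [ball]

@[simp]
theorem realize_bex {x : Fin n} {f : Fin (n + 1) → Fm (n + 1)} :
    (bex x f).Realize u v ↔ ∃ a, a ∈ᵥ v x ∧ (f (Fin.last n)).Realize u (Fin.snoc v a) := by
  simp [bex]

@[simp]
theorem realize_isSubset {x y : Fin n} :
    (isSubset x y).Realize u v ↔ ∀ z, z ∈ᵥ v x → z ∈ᵥ v y := by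
  simp [isSubset]

theorem realize_inst {α : Type} {φ : setLang.Formula α} {σ : α → Fin n} :
    (inst φ σ).Realize u v ↔ φ.Realize (fun i => v (σ i)) := by
  simp only [inst, Formula.Realize]
  have := BoundedFormula.realize_relabel (m := n) (n := 0) (φ := φ)
    (g := fun i => (Sum.inr (σ i) : Empty ⊕ Fin n)) (v := u) (xs := v)
  refine this.trans ?_
  congr! 1

end Realize

/-- The set `m` is transitive, in the sense of `V`. -/
def IsTrans (m : V) : Prop := ∀ x, x ∈ᵥ m → ∀ y, y ∈ᵥ x → y ∈ᵥ m

@[simp]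
theorem realize_isTransitive {u : Empty → V} {v : Fin n → V} {x : Fin n} :
    (isTransitive x).Realize u v ↔ IsTrans (v x) := by
  simp [isTransitive, IsTrans]

variable (V) in
/-- `V` satisfies the axioms Extensionality, Empty set, Pair and Union. -/
class BasicSets : Prop where
  ext : ∀ x y : V, (∀ z, z ∈ᵥ x ↔ z ∈ᵥ y) → x = y
  empty : ∃ e : V, ∀ z, ¬ z ∈ᵥ e
  pair : ∀ x y : V, ∃ p, ∀ z, z ∈ᵥ p ↔ z = x ∨ z = y
  union : ∀ x : V, ∃ u, ∀ z, z ∈ᵥ u ↔ ∃ y, y ∈ᵥ x ∧ z ∈ᵥ y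

theorem basicSets_of_BST (h : V ⊨ BST) : BasicSets V := by
  have key : ∀ σ ∈ ({emptyAx, extensionalityAx, pairAx, unionAx, productAx, omegaAx} :
      Set setLang.Sentence), V ⊨ σ := fun σ hσ => h.realize_of_mem σ (Or.inl hσ)
  have hext := key extensionalityAx (by simp)
  have hempty := key emptyAx (by simp)
  have hpair := key pairAx (by simp)
  have hunion := key unionAx (by simp)
  simp only [Sentence.Realize, Formula.Realize, extensionalityAx, emptyAx, isEmpty, pairAx, isPair,
    unionAx, realize_all, realize_ex, realize_bex, realize_mem, realize_eq,
    BoundedFormula.realize_imp, BoundedFormula.realize_iff, BoundedFormula.realize_sup,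
    BoundedFormula.realize_not, Fin.snoc_castSucc, Fin.snoc_last] at hext hempty hpair hunion
  exact ⟨hext, hempty, hpair, hunion⟩

/-! ### Numerals, finite sequences and codes of formulas -/

section Sets

variable [BasicSets V]

theorem ext_iff {x y : V} : x = y ↔ ∀ z, z ∈ᵥ x ↔ z ∈ᵥ y :=
  ⟨fun h _ => h ▸ Iff.rfl, BasicSets.ext x y⟩

theorem exists_adjoin (s x : V) : ∃ t, ∀ z, z ∈ᵥ t ↔ z ∈ᵥ s ∨ z = x := by
  obtain ⟨p, hp⟩ := BasicSets.pair x x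
  obtain ⟨q, hq⟩ := BasicSets.pair s p
  obtain ⟨t, ht⟩ := BasicSets.union q
  exact ⟨t, fun z => by simp [ht, hq, hp]⟩

noncomputable section

variable (V) in
/-- The empty set of `V`. -/
def emp : V := (BasicSets.empty (V := V)).choose

/-- The pair `{x, y}` in `V`. -/
def pr (x y : V) : V := (BasicSets.pair x y).choose

/-- The set `s ∪ {x}` in `V`. -/
def adj (s x : V) : V := (exists_adjoin s x).choose

/-- The Kuratowski pair `(x, y)` in `V`. -/
def op (x y : V) : V := pr (pr x x) (pr x y)

variable (V) in
/-- The set of `V` that represents the standard natural number `k`; the `ω` of `V` may have further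
members. -/
def num : ℕ → V
  | 0 => emp V
  | k + 1 => adj (num k) (num k)

@[simp] theorem not_mem_emp (z : V) : ¬ z ∈ᵥ emp V := (BasicSets.empty (V := V)).choose_spec z

@[simp] theorem mem_pr {x y z : V} : z ∈ᵥ pr x y ↔ z = x ∨ z = y :=
  (BasicSets.pair x y).choose_spec z

@[simp] theorem mem_adj {s x z : V} : z ∈ᵥ adj s x ↔ z ∈ᵥ s ∨ z = x :=
  (exists_adjoin s x).choose_spec z

theorem pr_inj {x y x' y' : V} : pr x y = pr x' y' ↔ x = x' ∧ y = y' ∨ x = y' ∧ y = x' := by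
  constructor
  · intro h
    have h' : ∀ z, (z = x ∨ z = y) ↔ (z = x' ∨ z = y') := by simpa using ext_iff.1 h
    have := h' x; have := h' y; have := h' x'; have := h' y'
    grind
  · rintro (⟨rfl, rfl⟩ | ⟨rfl, rfl⟩)
    · rfl
    · exact ext_iff.2 fun z => by simp [or_comm]

@[simp] theorem op_inj {x y x' y' : V} : op x y = op x' y' ↔ x = x' ∧ y = y' := by
  constructor
  · simp only [op, pr_inj]; grind
  · rintro ⟨rfl, rfl⟩; rfl

theorem mem_num {k : ℕ} {z : V} : z ∈ᵥ num V k ↔ ∃ i < k, z = num V i := by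
  induction k with
  | zero => simp [num]
  | succ k ih =>
    simp only [num, mem_adj, ih, Nat.lt_succ_iff_lt_or_eq, or_and_right, exists_or,
      exists_eq_left]

/-- There is no axiom of Foundation in `BST`, so this needs an induction. It makes the numerals
distinct. -/
theorem num_notMem_self (k : ℕ) : ¬ num V k ∈ᵥ num V k := by
  induction k with
  | zero => simp [num]
  | succ k ih =>
    intro h
    obtain ⟨i, hi, h'⟩ := mem_num.1 h
    have : num V k ∈ᵥ num V i := h' ▸ mem_num.2 ⟨k, k.lt_succ_self, rfl⟩
    obtain ⟨j, hj, h''⟩ := mem_num.1 this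
    exact ih (mem_num.2 ⟨j, by omega, h''⟩)

@[simp] theorem num_inj {i j : ℕ} : num V i = num V j ↔ i = j := by
  refine ⟨fun h => ?_, fun h => h ▸ rfl⟩
  rcases lt_trichotomy i j with hij | hij | hij
  · exact absurd (h ▸ (mem_num.2 ⟨i, hij, rfl⟩ : num V i ∈ᵥ num V j)) (num_notMem_self j)
  · exact hij
  · exact absurd (h ▸ (mem_num.2 ⟨j, hij, rfl⟩ : num V j ∈ᵥ num V i)) (num_notMem_self j)

/-- The function `{(0, s 0), …, (k - 1, s (k - 1))}` in `V`, for an actual finite sequence `s`. -/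
def tup : {k : ℕ} → (Fin k → V) → V
  | 0, _ => emp V
  | k + 1, s => adj (tup (Fin.init s)) (op (num V k) (s (Fin.last k)))

theorem mem_tup {k : ℕ} {s : Fin k → V} {p : V} :
    p ∈ᵥ tup s ↔ ∃ i : Fin k, p = op (num V i) (s i) := by
  induction k with
  | zero => simp [tup]
  | succ k ih => simp [tup, ih, Fin.exists_fin_succ', Fin.init]

@[simp] theorem adj_tup {k : ℕ} (s : Fin k → V) (x : V) :
    adj (tup s) (op (num V k) x) = tup (Fin.snoc s x : Fin (k + 1) → V) := by
  simp [tup]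

@[simp] theorem op_mem_tup {k : ℕ} {s : Fin k → V} {i : Fin k} {x : V} :
    op (num V i) x ∈ᵥ tup s ↔ x = s i := by
  simp only [mem_tup, op_inj, num_inj, Fin.val_inj]
  exact ⟨fun ⟨_, h, h'⟩ => h ▸ h', fun h => ⟨i, rfl, h⟩⟩

/-- The set `(k, (a, b))` of `V`, see `isTagged`. -/
def tag (k : ℕ) (a b : V) : V := op (num V k) (op a b)

variable (V) in
/-- The code in `V` of an actual formula. -/
def code : {k : ℕ} → Fm k → V
  | _, .falsum => tag 0 (emp V) (emp V)
  | _, .equal t₁ t₂ => tag 1 (num V (varIndex t₁)) (num V (varIndex t₂))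
  | _, .rel MemSymbol.mem ts => tag 2 (num V (varIndex (ts 0))) (num V (varIndex (ts 1)))
  | _, .imp φ ψ => tag 3 (code φ) (code ψ)
  | k, .all φ => tag 4 (num V k) (code φ)

variable {u : Empty → V} {v : Fin n → V}

@[simp] theorem realize_isEmpty {x : Fin n} : (isEmpty x).Realize u v ↔ v x = emp V := by
  simp [isEmpty, ext_iff]

@[simp] theorem realize_isPair {x y p : Fin n} :
    (isPair x y p).Realize u v ↔ v p = pr (v x) (v y) := by
  simp [isPair, ext_iff (x := v p)]

@[simp] theorem realize_isOPair {x y p : Fin n} :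
    (isOPair x y p).Realize u v ↔ v p = op (v x) (v y) := by
  simp [isOPair, op, ext_iff (x := v p)]

@[simp] theorem realize_opairMem {x y r : Fin n} :
    (opairMem x y r).Realize u v ↔ op (v x) (v y) ∈ᵥ v r := by
  simp [opairMem]

@[simp] theorem realize_isSucc {x y : Fin n} :
    (isSucc x y).Realize u v ↔ v y = adj (v x) (v x) := by
  simp [isSucc, ext_iff (x := v y)]

@[simp] theorem realize_isExtension {s d x t : Fin n} :
    (isExtension s d x t).Realize u v ↔ v t = adj (v s) (op (v d) (v x)) := by
  simp [isExtension, ext_iff (x := v t)]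

@[simp] theorem realize_isNumeral {k : ℕ} {x : Fin n} :
    (isNumeral k x).Realize u v ↔ v x = num V k := by
  induction k generalizing n with
  | zero => simp [isNumeral, num]
  | succ k ih => simp [isNumeral, num, ih]

@[simp] theorem realize_isTagged {k : ℕ} {a b c : Fin n} :
    (isTagged k a b c).Realize u v ↔ v c = tag k (v a) (v b) := by
  simp [isTagged, tag]

@[simp] theorem realize_isFalsumCode {c : Fin n} :
    (isFalsumCode c).Realize u v ↔ v c = tag 0 (emp V) (emp V) := by
  simp [isFalsumCode]

@[simp] theorem realize_isCodeOf {k : ℕ} (φ : Fm k) {n : ℕ} {v : Fin n → V} {c : Fin n} :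
    (isCodeOf φ c).Realize u v ↔ v c = code V φ := by
  induction φ generalizing n with
  | falsum => simp [isCodeOf, code]
  | equal t₁ t₂ => simp [isCodeOf, code, isEqCode]
  | rel R ts => cases R; simp [isCodeOf, code, isMemCode]
  | imp φ ψ ih₁ ih₂ => simp [isCodeOf, code, isImpCode, ih₁, ih₂]
  | all φ ih => simp [isCodeOf, code, isAllCode, ih]

theorem num_mem_of_isOmega {w : Fin n} (h : (isOmega w).Realize u v) (k : ℕ) :
    num V k ∈ᵥ v w := by
  simp only [isOmega, isInductive, BoundedFormula.realize_inf, realize_bex, realize_isEmpty,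
    Fin.snoc_last, Fin.snoc_castSucc, realize_ball, realize_isSucc, exists_eq_right] at h
  induction k with
  | zero => exact h.1.1
  | succ k ih => exact h.1.2 _ ih

end

end Sets

/-! ### The structure of the members of a set -/

section Substructure

variable {V : Type*} [setLang.Structure V]

/-- The type of the members of the set `m`. It is a structure for `{∈}` by restriction: this is the
structure `(m, ∈)`, seen from outside `V`. -/
@[ext]
structure Elts (m : V) where
  val : V
  property : val ∈ᵥ m

attribute [coe] Elts.val

instance (m : V) : CoeOut (Elts m) V := ⟨Elts.val⟩

instance (m : V) : setLang.Structure (Elts m) where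
  funMap f _ := Empty.elim f
  RelMap R ts := Structure.RelMap R fun i => (ts i : V)

theorem Elts.mem_iff {m : V} {x y : Elts m} : x ∈ᵥ y ↔ (x : V) ∈ᵥ (y : V) := by
  refine Iff.of_eq (congrArg (Structure.RelMap (L := setLang) (M := V) MemSymbol.mem) ?_)
  funext i
  fin_cases i <;> rfl

theorem Elts.coe_snoc {m : V} {k : ℕ} (s : Fin k → Elts m) (x : Elts m) (i : Fin (k + 1)) :
    ((Fin.snoc s x : Fin (k + 1) → Elts m) i : V) =
      (Fin.snoc (fun j => (s j : V)) (x : V) : Fin (k + 1) → V) i := by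
  refine Fin.lastCases ?_ (fun j => ?_) i <;> simp

theorem term_eq_var {α : Type*} (t : setLang.Term α) : ∃ a, t = Term.var a := by
  cases t with
  | var a => exact ⟨a, rfl⟩
  | func f _ => exact Empty.elim f

theorem exists_eq_var {k : ℕ} (t : setLang.Term (Empty ⊕ Fin k)) :
    ∃ i : Fin k, t = Term.var (Sum.inr i) := by
  obtain ⟨e | i, rfl⟩ := term_eq_var t
  exacts [e.elim, ⟨i, rfl⟩]

theorem rel_eq_memVar {α : Type} {k : ℕ} (ts : Fin 2 → setLang.Term (α ⊕ Fin k)) :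
    ∃ a b, ts 0 = Term.var a ∧ ts 1 = Term.var b ∧
      BoundedFormula.rel (L := setLang) MemSymbol.mem ts = memVar a b := by
  obtain ⟨a, ha⟩ := term_eq_var (ts 0)
  obtain ⟨b, hb⟩ := term_eq_var (ts 1)
  refine ⟨a, b, ha, hb, congrArg (BoundedFormula.rel (L := setLang) MemSymbol.mem) ?_⟩
  funext i
  fin_cases i
  exacts [ha, hb]

theorem realize_memVar {α : Type} {k : ℕ} {a b : α ⊕ Fin k} {v : α → V} {xs : Fin k → V} :
    (memVar a b).Realize v xs ↔ Sum.elim v xs a ∈ᵥ Sum.elim v xs b :=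
  BoundedFormula.realize_rel₂ (L := setLang) (R := MemSymbol.mem)
    (t₁ := Term.var a) (t₂ := Term.var b) (v := v) (xs := xs)

theorem realize_lastMem {α : Type} {k : ℕ} {a : α ⊕ Fin k} {v : α → V} {xs : Fin k → V} {x : V} :
    (lastMem a).Realize v (Fin.snoc xs x) ↔ x ∈ᵥ Sum.elim v xs a := by
  rw [lastMem, realize_memVar]
  rcases a with a | i <;> simp

end Substructure

/-! ### Absoluteness of `Δ₀` formulas and preservation of `Σ₁` formulas -/

section Absoluteness

variable {V : Type*} [setLang.Structure V] {α : Type}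

theorem Elts.coe_elim {m : V} {k : ℕ} {v : α → Elts m} {xs : Fin k → Elts m} (a : α ⊕ Fin k) :
    ((Sum.elim v xs a : Elts m) : V) = Sum.elim (fun i => (v i : V)) (fun i => (xs i : V)) a := by
  rcases a with a | i <;> rfl

theorem IsDelta0.realize_elts {k : ℕ} {φ : setLang.BoundedFormula α k} (hφ : IsDelta0 φ) {m : V}
    (hm : IsTrans m) (v : α → Elts m) (xs : Fin k → Elts m) :
    φ.Realize v xs ↔ φ.Realize (fun i => (v i : V)) (fun i => (xs i : V)) := by
  induction hφ with
  | falsum => rfl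
  | equal t₁ t₂ =>
    obtain ⟨a, rfl⟩ := term_eq_var t₁
    obtain ⟨b, rfl⟩ := term_eq_var t₂
    change Sum.elim v xs a = Sum.elim v xs b ↔ _ = _
    rw [Elts.ext_iff, Elts.coe_elim, Elts.coe_elim]
    rfl
  | rel R ts =>
    cases R
    obtain ⟨a, b, -, -, h⟩ := rel_eq_memVar ts
    rw [h, realize_memVar, realize_memVar, Elts.mem_iff, Elts.coe_elim, Elts.coe_elim]
  | imp _ _ ih₁ ih₂ => rw [BoundedFormula.realize_imp, BoundedFormula.realize_imp, ih₁, ih₂]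
  | ball a _ ih =>
    simp only [BoundedFormula.realize_all, BoundedFormula.realize_imp, realize_lastMem,
      Elts.mem_iff, Elts.coe_elim, ih, Elts.coe_snoc]
    refine ⟨fun h x hx => ?_, fun h x => h x⟩
    exact h ⟨x, hm _ (by rw [← Elts.coe_elim]; exact Elts.property _) x hx⟩ hx
  | bex a _ ih =>
    simp only [BoundedFormula.realize_ex, BoundedFormula.realize_inf, realize_lastMem,
      Elts.mem_iff, Elts.coe_elim, ih, Elts.coe_snoc]
    refine ⟨fun ⟨x, h⟩ => ⟨x, h⟩, fun ⟨x, hx, h⟩ => ?_⟩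
    exact ⟨⟨x, hm _ (by rw [← Elts.coe_elim]; exact Elts.property _) x hx⟩, hx, h⟩

/-- `Σ₁` formulas are preserved upwards from a transitive set to `V`. -/
theorem IsSigma1.realize_of_elts {k : ℕ} {φ : setLang.BoundedFormula α k} (hφ : IsSigma1 φ) {m : V}
    (hm : IsTrans m) (v : α → Elts m) (xs : Fin k → Elts m) (h : φ.Realize v xs) :
    φ.Realize (fun i => (v i : V)) (fun i => (xs i : V)) := by
  induction hφ with
  | delta0 hφ => exact (hφ.realize_elts hm v xs).1 h
  | ex _ ih =>
    obtain ⟨x, hx⟩ := BoundedFormula.realize_ex.1 h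
    have := ih _ hx
    simp only [Elts.coe_snoc] at this
    exact BoundedFormula.realize_ex.2 ⟨x, this⟩

variable [BasicSets V]

theorem IsTrans.mem_of_pr_mem {m x y : V} (hm : IsTrans m) (h : pr x y ∈ᵥ m) : x ∈ᵥ m ∧ y ∈ᵥ m :=
  ⟨hm _ h _ (by simp), hm _ h _ (by simp)⟩

/-- A true `Σ₁` formula holds in every transitive set that contains its parameters and a certain set
`w`, which has the witnesses for the quantifiers in its transitive closure. -/
theorem IsSigma1.exists_realize_elts {k : ℕ} {φ : setLang.BoundedFormula α k} (hφ : IsSigma1 φ)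
    (v : α → V) (xs : Fin k → V) (h : φ.Realize v xs) :
    ∃ w : V, ∀ m : V, IsTrans m → w ∈ᵥ m → ∀ (v' : α → Elts m) (xs' : Fin k → Elts m),
      (∀ i, (v' i : V) = v i) → (∀ i, (xs' i : V) = xs i) → φ.Realize v' xs' := by
  induction hφ with
  | delta0 hφ =>
    refine ⟨emp V, fun m hm _ v' xs' hv hxs => (hφ.realize_elts hm _ _).2 ?_⟩
    simpa only [hv, hxs] using h
  | ex _ ih =>
    obtain ⟨x, hx⟩ := BoundedFormula.realize_ex.1 h
    obtain ⟨w, hw⟩ := ih _ hx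
    refine ⟨pr x w, fun m hm hxw v' xs' hv hxs => BoundedFormula.realize_ex.2 ?_⟩
    obtain ⟨hxm, hwm⟩ := hm.mem_of_pr_mem hxw
    exact ⟨⟨x, hxm⟩, hw m hm hwm v' _ hv fun i => by simp only [Elts.coe_snoc, hxs]⟩

theorem exists_forall_mem_of_isTrans {k : ℕ} (v : Fin k → V) :
    ∃ w : V, ∀ m, IsTrans m → w ∈ᵥ m → ∀ i, v i ∈ᵥ m := by
  induction k with
  | zero => exact ⟨emp V, fun _ _ _ i => i.elim0⟩
  | succ k ih =>
    obtain ⟨w, hw⟩ := ih (Fin.init v)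
    refine ⟨pr w (v (Fin.last k)), fun m hm h => ?_⟩
    obtain ⟨h₁, h₂⟩ := hm.mem_of_pr_mem h
    exact Fin.lastCases h₂ (hw m hm h₁)

end Absoluteness

/-! ### Satisfaction relations and actual truth -/

section Truth

variable {V : Type*} [setLang.Structure V] [BasicSets V] {u : Empty → V} {v : Fin n → V}

theorem realize_isFunction_tup {s d m : Fin n} {M : V} (hM : v m = M) {k : ℕ} (t : Fin k → Elts M)
    (hd : v d = num V k) (hs : v s = tup fun i => (t i : V)) :
    (isFunction s d m).Realize u v := by
  subst hM
  simp only [isFunction, BoundedFormula.realize_inf, realize_ball, realize_bex, realize_isOPair,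
    realize_all, realize_opairMem, BoundedFormula.realize_imp, realize_eq, Fin.snoc_castSucc,
    Fin.snoc_last, hd, hs]
  constructor
  · intro p hp
    obtain ⟨i, rfl⟩ := mem_tup.1 hp
    exact ⟨_, mem_num.2 ⟨i, i.2, rfl⟩, _, (t i).2, rfl⟩
  · intro p hp
    obtain ⟨i, hi, rfl⟩ := mem_num.1 hp
    lift i to Fin k using hi
    exact ⟨_, (t i).2, by simp⟩

theorem code_mem_of_isFormationClosed {w F : Fin n} (hw : ∀ k, num V k ∈ᵥ v w)
    (hF : (isFormationClosed w F).Realize u v) {k : ℕ} (φ : Fm k) :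
    op (num V k) (code V φ) ∈ᵥ v F := by
  simp only [isFormationClosed, isEqCode, isMemCode, isImpCode, isAllCode,
    BoundedFormula.realize_inf, realize_ball, realize_all, BoundedFormula.realize_imp,
    BoundedFormula.realize_sup, realize_opairMem, realize_isFalsumCode, realize_isTagged,
    realize_isSucc, Fin.snoc_castSucc, Fin.snoc_last] at hF
  induction φ with
  | falsum => exact (hF _ (hw _)).1.1.1 _ rfl
  | @equal k t₁ t₂ =>
    obtain ⟨i, rfl⟩ := exists_eq_var t₁
    obtain ⟨j, rfl⟩ := exists_eq_var t₂
    exact (hF _ (hw _)).1.1.2 _ (mem_num.2 ⟨i, i.2, rfl⟩) _ (mem_num.2 ⟨j, j.2, rfl⟩) _ (.inl rfl)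
  | @rel k l R ts =>
    cases R
    obtain ⟨i, hi⟩ := exists_eq_var (ts 0)
    obtain ⟨j, hj⟩ := exists_eq_var (ts 1)
    simp only [code, hi, hj]
    exact (hF _ (hw _)).1.1.2 _ (mem_num.2 ⟨i, i.2, rfl⟩) _ (mem_num.2 ⟨j, j.2, rfl⟩) _ (.inr rfl)
  | imp φ ψ ih₁ ih₂ => exact (hF _ (hw _)).1.2 _ _ _ ⟨⟨ih₁, ih₂⟩, rfl⟩
  | all φ ih => exact (hF _ (hw _)).2 _ _ _ ⟨⟨rfl, ih⟩, rfl⟩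

/-- Any satisfaction relation for `(M, ∈)` in `V` decides the actual formulas correctly. The proof
is an induction on the actual formula `φ`, which never meets nonstandard elements of `ω`. The set
`M` is a variable of its own, since the type `Elts (v m)` would change when the valuation `v` is
extended. -/
theorem code_mem_satRelation {w F m T : Fin n} (hw : (isOmega w).Realize u v)
    (hF : (isFormulaSet w F).Realize u v) (hT : (isSatRelation w F m T).Realize u v)
    {M : V} (hM : v m = M) {k : ℕ} (φ : Fm k) (s : Fin k → Elts M) (e : Empty → Elts M) :
    op (code V φ) (tup fun i => (s i : V)) ∈ᵥ v T ↔ φ.Realize e s := by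
  subst hM
  replace hw := num_mem_of_isOmega hw
  replace hF : ∀ {k : ℕ} (φ : Fm k), _ := fun {k} φ =>
    code_mem_of_isFormationClosed hw (BoundedFormula.realize_inf.1 hF).1 φ
  replace hT := fun k (s : Fin k → Elts (v m)) =>
    BoundedFormula.realize_imp.1 (realize_all.1 (realize_ball.1 hT (num V k) (hw k))
      (tup fun i => (s i : V))) (realize_isFunction_tup (by simp) s (by simp) (by simp))
  simp only [isEqCode, isMemCode, isImpCode, isAllCode,
    BoundedFormula.realize_inf, realize_ball, realize_all, realize_ex, BoundedFormula.realize_imp,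
    BoundedFormula.realize_iff, BoundedFormula.realize_not, realize_mem,
    realize_opairMem, realize_isFalsumCode, realize_isTagged,
    realize_isSucc, realize_isExtension, Fin.snoc_castSucc, Fin.snoc_last] at hT
  induction φ with
  | falsum => exact iff_of_false ((hT _ s).1.1.1.1 _ rfl) id
  | equal t₁ t₂ =>
    obtain ⟨i, rfl⟩ := exists_eq_var t₁
    obtain ⟨j, rfl⟩ := exists_eq_var t₂
    refine ((hT _ s).1.1.1.2 _ (mem_num.2 ⟨i, i.2, rfl⟩) _ (mem_num.2 ⟨j, j.2, rfl⟩) _ rfl).trans ?_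
    simp only [op_mem_tup, exists_eq_left]
    exact Elts.ext_iff.symm
  | rel R ts =>
    cases R
    obtain ⟨_, _, ha, hb, h⟩ := rel_eq_memVar ts
    obtain ⟨i, hi⟩ := exists_eq_var (ts 0)
    obtain ⟨j, hj⟩ := exists_eq_var (ts 1)
    obtain rfl := Term.var.inj (ha.symm.trans hi)
    obtain rfl := Term.var.inj (hb.symm.trans hj)
    simp only [code, hi, hj]
    rw [h, realize_memVar]
    refine ((hT _ s).1.1.2 _ (mem_num.2 ⟨i, i.2, rfl⟩) _ (mem_num.2 ⟨j, j.2, rfl⟩) _ rfl).trans ?_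
    simp only [op_mem_tup, and_assoc, exists_eq_left, exists_and_left]
    exact Elts.mem_iff.symm
  | imp φ ψ ih₁ ih₂ =>
    exact ((hT _ s).1.2 _ _ _ ⟨⟨hF φ, hF ψ⟩, rfl⟩).trans (imp_congr (ih₁ s) (ih₂ s))
  | all φ ih =>
    rw [BoundedFormula.realize_all]
    refine ((hT _ s).2 _ _ _ ⟨⟨rfl, hF φ⟩, rfl⟩).trans ?_
    simp only [adj_tup, forall_eq, ← ih, Elts.coe_snoc]
    exact ⟨fun h x => h x x.2, fun h x hx => h ⟨x, hx⟩⟩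

theorem realize_powersetAx_of_isModel {m : Fin n} (h : (isModel m).Realize u v) {M : V}
    (hM : v m = M) : Elts M ⊨ powersetAx := by
  obtain ⟨-, h⟩ := BoundedFormula.realize_inf.1 h
  simp only [satisfiesZFC, realize_ex, BoundedFormula.realize_inf] at h
  obtain ⟨w, F, T, ⟨⟨⟨⟨hw, hF⟩, hT⟩, h⟩, -⟩, -⟩ := h
  simp only [zfcSingleAxioms, List.map_cons, List.foldr_cons, BoundedFormula.realize_inf] at h
  obtain ⟨-, -, -, -, h, -⟩ := h
  simp only [isTrueIn, realize_ex, BoundedFormula.realize_inf, realize_isCodeOf, realize_isEmpty,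
    realize_opairMem, Fin.snoc_castSucc, Fin.snoc_last] at h
  obtain ⟨c, e, ⟨rfl, rfl⟩, h⟩ := h
  have := (code_mem_satRelation hw hF hT (M := M) (by simpa) powersetAx default default).1
    (by simpa [tup] using h)
  exact this

/-- If `V` thinks that `(M, ∈) ≺ (M', ∈)`, then `Elts M` and `Elts M'` satisfy the same actual
formulas with parameters in `M`. -/
theorem realize_iff_of_isElementary {m m' : Fin n} (h : (isElementary m m').Realize u v)
    {M M' : V} (hM : v m = M) (hM' : v m' = M') {k : ℕ} (φ : Fm k) (s : Fin k → V)
    (hs : ∀ i, s i ∈ᵥ M) (hs' : ∀ i, s i ∈ᵥ M') (e : Empty → Elts M) (e' : Empty → Elts M') :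
    φ.Realize e (fun i => ⟨s i, hs i⟩) ↔ φ.Realize e' (fun i => ⟨s i, hs' i⟩) := by
  simp only [isElementary, BoundedFormula.realize_inf, realize_ex, realize_ball, realize_all,
    BoundedFormula.realize_imp, BoundedFormula.realize_iff, realize_opairMem,
    Fin.snoc_castSucc, Fin.snoc_last] at h
  obtain ⟨-, w, F, T, T', ⟨⟨⟨hw, hF⟩, hT⟩, hT'⟩, h⟩ := h
  have hmem := code_mem_of_isFormationClosed (num_mem_of_isOmega hw)
    (BoundedFormula.realize_inf.1 hF).1 φ
  have := h _ (by simpa using num_mem_of_isOmega hw k) (code V φ) (tup s)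
    ⟨by simpa using hmem, realize_isFunction_tup (M := M) (by simpa) (fun i => ⟨s i, hs i⟩)
      (by simp) (by simp)⟩
  rw [← code_mem_satRelation hw hF hT (by simpa) φ,
    ← code_mem_satRelation hw hF hT' (by simpa) φ]
  simpa using this

end Truth

/-! ### Strongly extendible models -/

section StronglyExtendible

variable {V : Type*} [setLang.Structure V] [BasicSets V]

/-- What strong extendibility of `m` in `V` says about the actual structures `Elts m`; of the axioms
of ZFC only Powerset is recorded. -/
structure StronglyExtendible (m : V) : Prop where
  trans : IsTrans m
  powerset : Elts m ⊨ powersetAx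
  extend : ∀ x : V, ∃ m' : V, x ∈ᵥ m' ∧ IsTrans m' ∧ (∀ y, y ∈ᵥ m → y ∈ᵥ m') ∧
    ∀ {k : ℕ} (φ : Fm k) (s : Fin k → V) (hs : ∀ i, s i ∈ᵥ m) (hs' : ∀ i, s i ∈ᵥ m'),
      (φ.Realize (M := Elts m) default (fun i => ⟨s i, hs i⟩) ↔
        φ.Realize (M := Elts m') default (fun i => ⟨s i, hs' i⟩))

theorem StronglyExtendible.of_realize {u : Empty → V} {v : Fin n → V} {m : Fin n}
    (h : (isStronglyExtendible m).Realize u v) : StronglyExtendible (v m) := by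
  simp only [isStronglyExtendible, realize_all, realize_ex, BoundedFormula.realize_inf,
    realize_mem, Fin.snoc_castSucc, Fin.snoc_last] at h
  obtain ⟨hm, hext⟩ := h
  refine ⟨realize_isTransitive.1 (BoundedFormula.realize_inf.1 hm).1,
    realize_powersetAx_of_isModel hm rfl, fun x => ?_⟩
  obtain ⟨m', ⟨hx, hm'⟩, hel⟩ := hext x
  have htrans := realize_isTransitive.1 (BoundedFormula.realize_inf.1 hm').1
  have hsub := realize_isSubset.1 (BoundedFormula.realize_inf.1 hel).1
  simp only [Fin.snoc_castSucc, Fin.snoc_last] at htrans hsub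
  exact ⟨m', hx, htrans, hsub, fun φ s hs hs' =>
    realize_iff_of_isElementary hel (by simp) (by simp) φ s hs hs' default default⟩

theorem exists_stronglyExtendible (h : V ⊨ locSextAx) (x : V) :
    ∃ m : V, x ∈ᵥ m ∧ StronglyExtendible m := by
  simp only [Sentence.Realize, Formula.Realize, locSextAx, realize_all, realize_ex,
    BoundedFormula.realize_inf, realize_mem, Fin.snoc_castSucc, Fin.snoc_last] at h
  obtain ⟨m, ⟨hx, -⟩, hm⟩ := h x
  have := StronglyExtendible.of_realize hm
  rw [Fin.snoc_last] at this
  exact ⟨m, hx, this⟩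

theorem realize_powersetAx (h : V ⊨ locSextAx) : V ⊨ powersetAx := by
  simp only [Sentence.Realize, Formula.Realize, powersetAx, realize_all, realize_ex,
    BoundedFormula.realize_iff, realize_mem, realize_isSubset, Fin.snoc_castSucc, Fin.snoc_last]
  intro a
  obtain ⟨m, ha, hm⟩ := exists_stronglyExtendible h a
  have hpow := hm.powerset
  simp only [Sentence.Realize, Formula.Realize, powersetAx, realize_all, realize_ex,
    BoundedFormula.realize_iff, realize_mem, realize_isSubset, Fin.snoc_castSucc, Fin.snoc_last,
    Elts.mem_iff] at hpow
  obtain ⟨b, hab⟩ := hpow ⟨a, ha⟩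
  -- `θ` says that the second variable is the powerset of the first.
  let θ : Fm 2 := all fun z => mem z ⇡(Fin.last 1) ⇔ isSubset z ⇡⇡(Fin.last 0)
  let s : Fin 2 → V := Fin.snoc (Fin.snoc (default : Fin 0 → V) a : Fin 1 → V) b
  have hs {m' : V} (ha : a ∈ᵥ m') (hb : (b : V) ∈ᵥ m') (i : Fin 2) : s i ∈ᵥ m' := by
    fin_cases i
    exacts [ha, hb]
  have hθ {m' : V} (ha : a ∈ᵥ m') (hb : (b : V) ∈ᵥ m') :
      θ.Realize (M := Elts m') default (fun i => ⟨s i, hs ha hb i⟩) ↔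
        ∀ z : Elts m', (z : V) ∈ᵥ b ↔ ∀ y : Elts m', (y : V) ∈ᵥ z → (y : V) ∈ᵥ a := by
    simp only [θ, s, realize_all, BoundedFormula.realize_iff, realize_mem, realize_isSubset,
      Fin.snoc_castSucc, Fin.snoc_last, Elts.mem_iff]
  refine ⟨b, fun z => ⟨fun hz y hy => ?_, fun hz => ?_⟩⟩
  · have hzm := hm.trans _ b.2 _ hz
    exact (hab ⟨z, hzm⟩).1 hz ⟨y, hm.trans _ hzm _ hy⟩ hy
  · obtain ⟨m', hzm', -, hsub, hel⟩ := hm.extend z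
    have hab' := (hθ (hsub a ha) (hsub b b.2)).1 ((hel θ s _ _).1 ((hθ ha b.2).2 hab))
    exact (hab' ⟨z, hzm'⟩).2 fun y => hz y

theorem realize_collectionAx (h : V ⊨ locSextAx) {φ : setLang.Formula (Fin n ⊕ Fin 2)}
    (hφ : IsSigma1 φ) : V ⊨ collectionAx φ := by
  refine BoundedFormula.realize_alls.2 fun v => ?_
  simp only [realize_all, realize_ex, realize_ball, realize_bex, BoundedFormula.realize_imp,
    realize_inst, Fin.snoc_castSucc, Fin.snoc_last]
  intro a ha
  obtain ⟨w, hw⟩ := exists_forall_mem_of_isTrans (Fin.snoc v a : Fin (n + 1) → V)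
  obtain ⟨m, hwm, hm⟩ := exists_stronglyExtendible h w
  have hva := hw m hm.trans hwm
  have ham : a ∈ᵥ m := by simpa using hva (Fin.last n)
  -- The strongly extendible set `m` itself collects the witnesses.
  refine ⟨m, fun x hx => ?_⟩
  obtain ⟨y, hy⟩ := ha x hx
  let θ : Fm (n + 1) := ex fun y => inst φ (Sum.elim (fun i => ⇡⇡i) ![⇡(Fin.last n), y])
  let s : Fin (n + 1) → V := Fin.snoc v x
  have hs (i : Fin (n + 1)) : s i ∈ᵥ m := by
    refine Fin.lastCases ?_ (fun j => ?_) i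
    · simpa [s] using hm.trans a ham x hx
    · simpa [s] using hva j.castSucc
  obtain ⟨w', hw'⟩ := hφ.exists_realize_elts _ _ hy
  obtain ⟨m', hwym', hm', hsub, hel⟩ := hm.extend (pr w' y)
  obtain ⟨hw'm', hym'⟩ := hm'.mem_of_pr_mem hwym'
  have hθ' : θ.Realize (M := Elts m') default (fun i => ⟨s i, hsub _ (hs i)⟩) := by
    refine realize_ex.2 ⟨⟨y, hym'⟩, realize_inst.2 ?_⟩
    refine hw' m' hm' hw'm' _ _ (fun j => ?_) fun i => i.elim0
    rw [Elts.coe_snoc]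
    rcases j with i | j
    · simp [s]
    · fin_cases j <;> simp [s]
  obtain ⟨z, hz⟩ := realize_ex.1 ((hel θ s hs _).2 hθ')
  refine ⟨z, z.2, ?_⟩
  have := hφ.realize_of_elts hm.trans _ _ (realize_inst.1 hz)
  simp only [Elts.coe_snoc] at this
  rw [Formula.Realize]
  refine (iff_of_eq (congrArg₂ (BoundedFormula.Realize φ) (funext fun j => ?_)
    (Subsingleton.elim _ _))).2 this
  rcases j with i | j
  · simp [s]
  · fin_cases j <;> simp [s]

end StronglyExtendible

end LocalZFC

theorem theorem3p10 :
    (LocalZFC.LZFCsext ⊨ᵇ LocalZFC.powersetAx) ∧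
    ∀ (n : ℕ) (φ : LocalZFC.setLang.Formula (Fin n ⊕ Fin 2)), LocalZFC.IsSigma1 φ →
      LocalZFC.LZFCsext ⊨ᵇ LocalZFC.collectionAx φ := by
  have key (V : LocalZFC.LZFCsext.ModelType) :
      LocalZFC.BasicSets V ∧ V ⊨ LocalZFC.locSextAx := by
    have hV : V ⊨ LocalZFC.LZFCsext := V.is_model
    exact ⟨LocalZFC.basicSets_of_BST (hV.mono fun _ h => Or.inl (Or.inl h)),
      hV.realize_of_mem _ (Or.inr rfl)⟩
  refine ⟨fun V v xs => ?_, fun n φ hφ V v xs => ?_⟩ <;>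
    obtain ⟨_, hV⟩ := key V <;>
    rw [Subsingleton.elim v default, Subsingleton.elim xs default]
  · exact LocalZFC.realize_powersetAx hV
  · exact LocalZFC.realize_collectionAx hV hφ
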